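/- Let $d\ge 1$ and let $\Omega\subset\mathbb{R}^d$ be a bounded domain with smooth boundary $\Gamma:=\partial\Omega$, where $\Gamma$ carries its $(d-1)$-dimensional surface measure. Let $\mathbf{H}:=L^2(\Omega)\times L^2(\Gamma)$ (real-valued functions), a Hilbert space with norm $|(u,u_\Gamma)|_{\mathbf H}=\bigl(|u|_{L^2(\Omega)}^2+|u_\Gamma|_{L^2(\Gamma)}^2\bigr)^{1/2}$, and let $$\mathbf{V}:=\bigl\{(u,u_\Gamma)\in H^1(\Omega)\times H^1(\Gamma)\,:\ u_{|_\Gamma}=u_\Gamma\ \text{ a.e. on }\Gamma\bigr\},$$ where $u_{|_\Gamma}$ denotes the trace of $u$ on $\Gamma$. Then $\mathbf{V}$ is dense in $\mathbf{H}$. -/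

import Mathlib

open MeasureTheory Filter Topology
open scoped ContDiff

noncomputable section

namespace DynBdry

/-- `ℝᵈ` with the Euclidean norm. -/
abbrev E (d : ℕ) : Type := EuclideanSpace ℝ (Fin d)

/-- A bounded domain (nonempty, open, connected) of `ℝᵈ` with smooth boundary: near each boundary
point, after a linear isometry splitting `ℝᵈ` as `ℝᵈ⁻¹ × ℝ`, the set `Ω` is the region strictly
above the graph of a `C^∞` function. -/
structure IsBoundedSmoothDomain {d : ℕ} (Ω : Set (E d)) : Prop where
  isOpen : IsOpen Ω
  isConnected : IsConnected Ω
  isBounded : Bornology.IsBounded Ω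
  smooth_boundary : ∀ x ∈ frontier Ω, ∃ r > (0 : ℝ),
    ∃ e : E d ≃ₗᵢ[ℝ] WithLp 2 (E (d - 1) × ℝ), ∃ γ : E (d - 1) → ℝ, ContDiff ℝ ∞ γ ∧
      ∀ y ∈ Metric.ball x r, y ∈ Ω ↔ γ (e y).fst < (e y).snd

/-- Lebesgue measure on `Ω`. -/
def bulkMeasure {d : ℕ} (Ω : Set (E d)) : Measure (E d) := volume.restrict Ω

/-- The surface measure on `Γ = ∂Ω`: the `(d-1)`-dimensional Hausdorff measure on `Γ`, with the
normalization which agrees with Lebesgue measure on `ℝᵈ⁻¹`. -/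
def surfaceMeasure {d : ℕ} (Ω : Set (E d)) : Measure (E d) :=
  (Measure.euclideanHausdorffMeasure (d - 1)).restrict (frontier Ω)

/-- `∂ᵢ φ` (classical). -/
def partialDeriv {k : ℕ} (i : Fin k) (φ : E k → ℝ) (x : E k) : ℝ :=
  fderiv ℝ φ x (EuclideanSpace.single i 1)

/-- `g` is the weak `i`-th partial derivative of `f` on the open set `U`; used only for `f`, `g`
locally square integrable on `U`. -/
def HasWeakPartialDeriv {k : ℕ} (U : Set (E k)) (i : Fin k) (f g : E k → ℝ) : Prop :=
  ∀ η : E k → ℝ, ContDiff ℝ ∞ η → HasCompactSupport η → tsupport η ⊆ U →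
    ∫ x in U, f x * partialDeriv i η x = - ∫ x in U, g x * η x

/-- `f` belongs to `H¹(U)`. -/
def MemH1 {k : ℕ} (U : Set (E k)) (f : E k → ℝ) : Prop :=
  MemLp f 2 (volume.restrict U) ∧
    ∀ i, ∃ g : E k → ℝ, MemLp g 2 (volume.restrict U) ∧ HasWeakPartialDeriv U i f g

/-- `f` belongs to `L²_loc(U)`. -/
def MemL2Loc {k : ℕ} (U : Set (E k)) (f : E k → ℝ) : Prop :=
  ∀ K : Set (E k), IsCompact K → K ⊆ U → MemLp f 2 (volume.restrict K)

/-- `f` belongs to `H¹_loc(U)`. -/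
def MemH1Loc {k : ℕ} (U : Set (E k)) (f : E k → ℝ) : Prop :=
  MemL2Loc U f ∧ ∀ i, ∃ g : E k → ℝ, MemL2Loc U g ∧ HasWeakPartialDeriv U i f g

/-- `ψ : W → S` is a smooth local parametrization of the hypersurface `S ⊆ ℝᵈ`: `W ⊆ ℝᵈ⁻¹` is open
and `ψ` is a smooth immersion which maps `W` homeomorphically onto a relatively open subset
of `S`. -/
structure IsLocalParam {d : ℕ} (S : Set (E d)) (W : Set (E (d - 1)))
    (ψ : E (d - 1) → E d) : Prop where
  isOpen : IsOpen W
  contDiffOn : ContDiffOn ℝ ∞ ψ W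
  immersion : ∀ y ∈ W, Function.Injective (fderiv ℝ ψ y)
  isOpenEmbedding : ∃ h : Set.MapsTo ψ W S, IsOpenEmbedding (h.restrict ψ W S)

/-- `g` belongs to `H¹(Γ)`, `Γ = ∂Ω`: it is in `L²(Γ)` and all its expressions in local
coordinates of `Γ` have locally square integrable weak first derivatives. As `Γ` is compact,
finitely many compact coordinate patches cover it, so the local condition is the global one. -/
def MemH1Boundary {d : ℕ} (Ω : Set (E d)) (g : E d → ℝ) : Prop :=
  MemLp g 2 (surfaceMeasure Ω) ∧
    ∀ (W : Set (E (d - 1))) (ψ : E (d - 1) → E d), IsLocalParam (frontier Ω) W ψ →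
      MemH1Loc W (g ∘ ψ)

/-- `g ∈ L²(Γ)` is the trace on `Γ = ∂Ω` of `u ∈ H¹(Ω)`. The trace operator is the continuous
extension to `H¹(Ω)`, with values in `L²(Γ)`, of the restriction to `Γ` of functions smooth up to
the boundary: `g` is the trace of `u` if some functions `φ n`, smooth on `ℝᵈ`, converge to `u` in
`H¹(Ω)` while their restrictions to `Γ` converge to `g` in `L²(Γ)`. -/
def IsTrace {d : ℕ} (Ω : Set (E d)) (u g : E d → ℝ) : Prop :=
  ∃ Du : Fin d → E d → ℝ,
    (∀ i, MemLp (Du i) 2 (bulkMeasure Ω) ∧ HasWeakPartialDeriv Ω i u (Du i)) ∧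
    ∃ φ : ℕ → E d → ℝ, (∀ n, ContDiff ℝ ∞ (φ n)) ∧
      Tendsto (fun n => eLpNorm (fun x => φ n x - u x) 2 (bulkMeasure Ω)) atTop (𝓝 0) ∧
      (∀ i, Tendsto (fun n => eLpNorm (fun x => partialDeriv i (φ n) x - Du i x) 2
        (bulkMeasure Ω)) atTop (𝓝 0)) ∧
      Tendsto (fun n => eLpNorm (fun x => φ n x - g x) 2 (surfaceMeasure Ω)) atTop (𝓝 0)

/-- The Hilbert space `𝐇 = L²(Ω) × L²(Γ)`, with norm `(|u|² + |u_Γ|²)^{1/2}`. -/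
abbrev HSpace {d : ℕ} (Ω : Set (E d)) : Type :=
  WithLp 2 (Lp ℝ 2 (bulkMeasure Ω) × Lp ℝ 2 (surfaceMeasure Ω))

/-- `𝐕 = {(u, u_Γ) ∈ H¹(Ω) × H¹(Γ) : u|_Γ = u_Γ a.e. on Γ}`, as a subset of `𝐇`. -/
def VSpace {d : ℕ} (Ω : Set (E d)) : Set (HSpace Ω) :=
  {p | MemH1 Ω p.fst ∧ MemH1Boundary Ω p.snd ∧ IsTrace Ω p.fst p.snd}

end DynBdry

end

/-! Bulk and surface measure are mutually singular: `Ω` is open, hence disjoint from its frontier. A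
pair `(u, u_Γ)` is therefore a single function in `L²(μ + ν)` on `ℝᵈ`, and since both measures are
finite, one test function `φ` approximates both components
(`exists_contDiff_eLpNorm_sub_le_and_le`). No compatibility between `u` and `u_Γ` is needed. The
pair of restrictions of `φ` lies in `𝐕` (`mem_VSpace_of_ae_eq`). Smoothness of `Γ` enters through
the finiteness of its surface measure. -/

namespace DynBdry

open scoped NNReal

/-! ### Finiteness of the surface measure -/

theorem euclideanHausdorffMeasure_image_lt_top {X Y : Type*} [MetricSpace X] [MetricSpace Y]
    [MeasurableSpace X] [BorelSpace X] [MeasurableSpace Y] [BorelSpace Y] {K : ℝ≥0} {f : X → Y}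
    {s : Set X} {k : ℕ} (hf : LipschitzOnWith K f s)
    (hs : (Measure.euclideanHausdorffMeasure k : Measure X) s < ⊤) :
    (Measure.euclideanHausdorffMeasure k : Measure Y) (f '' s) < ⊤ := by
  have h0 := Measure.addHaarScalarFactor_volume_hausdorffMeasure_ne_zero k
  rw [Measure.euclideanHausdorffMeasure_def, Measure.smul_apply, ENNReal.smul_def, smul_eq_mul]
    at hs ⊢
  have h1 : (Measure.hausdorffMeasure (k : ℝ) : Measure X) s < ⊤ := by
    by_contra h
    rw [not_lt_top_iff.1 h, ENNReal.mul_top (by exact_mod_cast h0)] at hs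
    exact hs.ne rfl
  refine ENNReal.mul_lt_top ENNReal.coe_lt_top
    ((hf.hausdorffMeasure_image_le (Nat.cast_nonneg k)).trans_lt (ENNReal.mul_lt_top ?_ h1))
  exact ENNReal.rpow_lt_top_of_nonneg (Nat.cast_nonneg k) ENNReal.coe_ne_top

theorem graph_eq_of_mem_frontier {d : ℕ} {Ω : Set (E d)} (hΩ : IsOpen Ω) {x : E d} {r : ℝ}
    {a b : E d → ℝ} (ha : Continuous a) (hb : Continuous b)
    (h : ∀ y ∈ Metric.ball x r, y ∈ Ω ↔ a y < b y) {y : E d} (hy : y ∈ Metric.ball x r)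
    (hyΓ : y ∈ frontier Ω) : a y = b y := by
  rw [hΩ.frontier_eq] at hyΓ
  refine le_antisymm ?_ (not_lt.1 fun hlt => hyΓ.2 ((h y hy).2 hlt))
  have hsub : Metric.ball x r ∩ Ω ⊆ {z | a z ≤ b z} := fun z hz => ((h z hz.1).1 hz.2).le
  exact closure_minimal hsub (isClosed_le ha hb)
    (Metric.isOpen_ball.inter_closure ⟨hy, hyΓ.1⟩)

theorem IsBoundedSmoothDomain.isCompact_frontier {d : ℕ} {Ω : Set (E d)}
    (hΩ : IsBoundedSmoothDomain Ω) : IsCompact (frontier Ω) :=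
  hΩ.isBounded.isCompact_closure.of_isClosed_subset isClosed_frontier frontier_subset_closure

theorem IsBoundedSmoothDomain.isFiniteMeasure_surfaceMeasure {d : ℕ} {Ω : Set (E d)}
    (hΩ : IsBoundedSmoothDomain Ω) : IsFiniteMeasure (surfaceMeasure Ω) := by
  refine ⟨?_⟩
  rw [surfaceMeasure, Measure.restrict_apply_univ]
  refine hΩ.isCompact_frontier.measure_lt_top_of_nhdsWithin fun x hx => ?_
  obtain ⟨r, hr, e, γ, hγ, h⟩ := hΩ.smooth_boundary x hx
  let G : E (d - 1) → E d := fun z => e.symm (WithLp.toLp 2 (z, γ z))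
  have hG : ContDiff ℝ ∞ G := by
    refine e.symm.contDiff.comp ?_
    exact (WithLp.prodContinuousLinearEquiv 2 ℝ (E (d - 1)) ℝ).symm.contDiff.comp
      (contDiff_id.prodMk hγ)
  have hfst : Continuous fun y => (e y).fst :=
    (WithLp.continuous_fst 2 _ _).comp e.continuous
  have hsnd : Continuous fun y => (e y).snd :=
    (WithLp.continuous_snd 2 _ _).comp e.continuous
  obtain ⟨K, t, ht, hK⟩ :=
    (hG.contDiffAt (x := (e x).fst)).of_le (by simp) |>.exists_lipschitzOnWith
  -- The unit ball only keeps the volume of the parameter set finite.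
  set s := t ∩ Metric.ball (e x).fst 1
  have hs : s ∈ 𝓝 (e x).fst := inter_mem ht (Metric.ball_mem_nhds _ one_pos)
  refine ⟨frontier Ω ∩ (Metric.ball x r ∩ (fun y => (e y).fst) ⁻¹' s),
    inter_mem self_mem_nhdsWithin (mem_nhdsWithin_of_mem_nhds
      (inter_mem (Metric.ball_mem_nhds x hr) (hfst.continuousAt.preimage_mem_nhds hs))), ?_⟩
  refine (measure_mono (t := G '' s) ?_).trans_lt
    (euclideanHausdorffMeasure_image_lt_top (hK.mono Set.inter_subset_left) ?_)
  · rintro y ⟨hyΓ, hyb, hys⟩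
    refine ⟨_, hys, ?_⟩
    have := graph_eq_of_mem_frontier hΩ.isOpen (hγ.continuous.comp hfst) hsnd h hyb hyΓ
    simp only [Function.comp_apply] at this
    simp only [G, this]
    exact e.symm_apply_apply y
  · rw [EuclideanSpace.euclideanHausdorffMeasure_eq_volume]
    exact (measure_mono Set.inter_subset_right).trans_lt measure_ball_lt_top

theorem IsBoundedSmoothDomain.isFiniteMeasure_bulkMeasure {d : ℕ} {Ω : Set (E d)}
    (hΩ : IsBoundedSmoothDomain Ω) : IsFiniteMeasure (bulkMeasure Ω) :=
  ⟨by rw [bulkMeasure, Measure.restrict_apply_univ]; exact hΩ.isBounded.measure_lt_top⟩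

/-! ### Local parametrizations pull surface-null sets back to null sets -/

/-- An injective `f'` on a finite-dimensional space expands distances by at least `K⁻¹`; near `x`
the error `f - f'` is `(2 * K)⁻¹`-Lipschitz, too small to destroy this. -/
theorem _root_.HasStrictFDerivAt.exists_antilipschitzWith_restrict {V W : Type*}
    [NormedAddCommGroup V] [NormedSpace ℝ V] [FiniteDimensional ℝ V]
    [NormedAddCommGroup W] [NormedSpace ℝ W] {f : V → W} {f' : V →L[ℝ] W} {x : V}
    (hf : HasStrictFDerivAt f f' x) (hinj : Function.Injective f') :
    ∃ s ∈ 𝓝 x, ∃ K : ℝ≥0, AntilipschitzWith K (s.domRestrict f) := by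
  obtain ⟨K, hK0, hK⟩ := (f' : V →ₗ[ℝ] W).injective_iff_antilipschitz.1 hinj
  have hc : 0 < (2 * K)⁻¹ := by positivity
  obtain ⟨s, hs, h⟩ := hf.approximates_deriv_on_nhds (c := (2 * K)⁻¹) (Or.inr hc)
  have hlt : (2 * K)⁻¹ < K⁻¹ := by
    rw [mul_inv, mul_comm, ← div_eq_mul_inv]
    exact NNReal.half_lt_self (inv_pos.2 hK0).ne'
  exact ⟨s, hs, _, (hK.domRestrict s).add_sub_lipschitzWith (g := s.domRestrict f)
    h.lipschitz_sub hlt⟩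

/-- An immersion has local Lipschitz inverses, and these preserve Hausdorff-null sets. -/
theorem euclideanHausdorffMeasure_null_of_immersion {k d : ℕ} {W : Set (E k)} (hW : IsOpen W)
    {ψ : E k → E d} (hψ : ContDiffOn ℝ ∞ ψ W)
    (hinj : ∀ y ∈ W, Function.Injective (fderiv ℝ ψ y)) {N : Set (E d)}
    (hN : (Measure.euclideanHausdorffMeasure k : Measure (E d)) N = 0) :
    volume (W ∩ ψ ⁻¹' N) = 0 := by
  have h0 := Measure.addHaarScalarFactor_volume_hausdorffMeasure_ne_zero k
  have hN' : (Measure.hausdorffMeasure (k : ℝ) : Measure (E d)) N = 0 := by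
    rw [Measure.euclideanHausdorffMeasure_def, Measure.smul_apply, ENNReal.smul_def, smul_eq_mul]
      at hN
    exact (mul_eq_zero.1 hN).resolve_left (by exact_mod_cast h0)
  refine measure_null_of_locally_null _ fun x hx => ?_
  have hs : HasStrictFDerivAt ψ (fderiv ℝ ψ x) x :=
    (hψ.contDiffAt (hW.mem_nhds hx.1)).hasStrictFDerivAt (by simp)
  obtain ⟨s, hs, K, hK⟩ := hs.exists_antilipschitzWith_restrict (hinj x hx.1)
  refine ⟨_, inter_mem self_mem_nhdsWithin (mem_nhdsWithin_of_mem_nhds hs), ?_⟩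
  have hpre := hK.hausdorffMeasure_preimage_le (Nat.cast_nonneg k) N
  rw [hN', mul_zero, nonpos_iff_eq_zero] at hpre
  have himg := isometry_subtype_coe.hausdorffMeasure_image (X := s) (d := (k : ℝ))
    (Or.inl (Nat.cast_nonneg k)) (s.domRestrict ψ ⁻¹' N)
  rw [hpre] at himg
  rw [← EuclideanSpace.euclideanHausdorffMeasure_eq_volume, Measure.euclideanHausdorffMeasure_def,
    Measure.smul_apply, measure_mono_null _ himg, smul_zero]
  rintro y ⟨⟨-, hyN⟩, hys⟩
  exact ⟨⟨y, hys⟩, hyN, rfl⟩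

/-- Needed because `MemH1Boundary` is tested on the representative of an `Lp` class, which equals
`φ` only almost everywhere. -/
theorem IsLocalParam.ae_eq_comp {d : ℕ} {S : Set (E d)} {W : Set (E (d - 1))}
    {ψ : E (d - 1) → E d} (hψ : IsLocalParam S W ψ) {f g : E d → ℝ}
    (h : f =ᵐ[(Measure.euclideanHausdorffMeasure (d - 1)).restrict S] g) (hS : MeasurableSet S) :
    f ∘ ψ =ᵐ[volume.restrict W] g ∘ ψ := by
  rw [EventuallyEq, ae_restrict_iff' hS] at h
  obtain ⟨hmaps, -⟩ := hψ.isOpenEmbedding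
  rw [EventuallyEq, ae_restrict_iff' hψ.isOpen.measurableSet, ae_iff]
  refine measure_mono_null ?_
    (euclideanHausdorffMeasure_null_of_immersion hψ.isOpen hψ.contDiffOn hψ.immersion h)
  intro y hy
  simp only [Set.mem_ofPred_eq, Classical.not_imp] at hy
  exact ⟨hy.1, fun hc => hy.2 (hc (hmaps hy.1))⟩

/-! ### Smooth functions have weak derivatives -/

theorem HasWeakPartialDeriv.congr_ae {k : ℕ} {U : Set (E k)} {i : Fin k} {f f' g : E k → ℝ}
    (h : HasWeakPartialDeriv U i f g) (hf : f' =ᵐ[volume.restrict U] f) :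
    HasWeakPartialDeriv U i f' g := by
  intro η h1 h2 h3
  rw [← h η h1 h2 h3]
  refine integral_congr_ae ?_
  filter_upwards [hf] with x hx
  rw [hx]

theorem _root_.ContinuousOn.continuous_mul_of_tsupport_subset {X : Type*} [TopologicalSpace X]
    {U : Set X} (hU : IsOpen U) {f η : X → ℝ} (hf : ContinuousOn f U) (hη : Continuous η)
    (h : tsupport η ⊆ U) : Continuous fun x => f x * η x := by
  refine (hf.mul hη.continuousOn).continuous_of_tsupport_subset hU ?_
  exact (closure_mono (Function.support_mul_subset_right f η)).trans h

theorem hasWeakPartialDeriv_of_contDiffOn {k : ℕ} {U : Set (E k)} (hU : IsOpen U)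
    {f : E k → ℝ} (hf : ContDiffOn ℝ ∞ f U) (i : Fin k) :
    HasWeakPartialDeriv U i f (partialDeriv i f) := by
  intro η h1 h2 h3
  have hη' : Continuous (partialDeriv i η) :=
    (h1.continuous_fderiv (by simp)).clm_apply continuous_const
  have hsupp : Function.support (partialDeriv i η) ⊆ tsupport η := fun x hx =>
    support_fderiv_subset ℝ (fun h0 => hx (by simp [partialDeriv, h0]))
  have hsupp' : tsupport (partialDeriv i η) ⊆ tsupport η :=
    closure_minimal hsupp (isClosed_tsupport η)
  have hη'c : HasCompactSupport (partialDeriv i η) := h2.mono' hsupp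
  have hf' : ContinuousOn (partialDeriv i f) U :=
    (hf.continuousOn_fderiv_of_isOpen hU (by simp)).clm_apply continuousOn_const
  -- Both integrands vanish off `U`, so integration by parts takes place on the whole space; `f`
  -- need be differentiable only on `tsupport η`.
  rw [setIntegral_eq_integral_of_forall_compl_eq_zero, setIntegral_eq_integral_of_forall_compl_eq_zero]
  · refine integral_mul_fderiv_eq_neg_fderiv_mul_of_integrable ?_ ?_ ?_ ?_ ?_
    · exact (hf'.continuous_mul_of_tsupport_subset hU h1.continuous h3).integrable_of_hasCompactSupport
        h2.mul_left
    · exact (hf.continuousOn.continuous_mul_of_tsupport_subset hU hη'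
        (hsupp'.trans h3)).integrable_of_hasCompactSupport hη'c.mul_left
    · exact (hf.continuousOn.continuous_mul_of_tsupport_subset hU h1.continuous
        h3).integrable_of_hasCompactSupport h2.mul_left
    · exact fun x hx => (hf.contDiffAt (hU.mem_nhds (h3 hx))).differentiableAt (by simp)
    · exact fun x _ => (h1.differentiable (by simp)) x
  · intro x hx
    rw [image_eq_zero_of_notMem_tsupport fun h => hx (h3 h), mul_zero]
  · intro x hx
    rw [Function.notMem_support.1 fun h => hx (h3 (hsupp h)), mul_zero]

theorem _root_.ContinuousOn.memL2Loc {k : ℕ} {U : Set (E k)} {f : E k → ℝ}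
    (hf : ContinuousOn f U) : MemL2Loc U f := by
  intro K hK hKU
  have : IsFiniteMeasure (volume.restrict K) :=
    ⟨by rw [Measure.restrict_apply_univ]; exact hK.measure_lt_top⟩
  obtain ⟨C, hC⟩ := hK.exists_bound_of_continuousOn (hf.mono hKU)
  exact MemLp.of_bound ((hf.mono hKU).aestronglyMeasurable hK.measurableSet) C
    ((ae_restrict_iff' hK.measurableSet).2 (ae_of_all _ hC))

theorem memH1Loc_of_contDiffOn {k : ℕ} {U : Set (E k)} (hU : IsOpen U)
    {f : E k → ℝ} (hf : ContDiffOn ℝ ∞ f U) : MemH1Loc U f :=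
  ⟨hf.continuousOn.memL2Loc, fun i => ⟨partialDeriv i f,
    ((hf.continuousOn_fderiv_of_isOpen hU (by simp)).clm_apply continuousOn_const).memL2Loc,
    hasWeakPartialDeriv_of_contDiffOn hU hf i⟩⟩

theorem MemL2Loc.congr_ae {k : ℕ} {U : Set (E k)} {f f' : E k → ℝ}
    (h : MemL2Loc U f) (hf : f' =ᵐ[volume.restrict U] f) : MemL2Loc U f' := fun K hK hKU =>
  (memLp_congr_ae (ae_restrict_of_ae_restrict_of_subset hKU hf)).2 (h K hK hKU)

theorem MemH1Loc.congr_ae {k : ℕ} {U : Set (E k)} {f f' : E k → ℝ}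
    (h : MemH1Loc U f) (hf : f' =ᵐ[volume.restrict U] f) : MemH1Loc U f' :=
  ⟨h.1.congr_ae hf, fun i =>
    let ⟨g, hg, hw⟩ := h.2 i
    ⟨g, hg, hw.congr_ae hf⟩⟩

/-! ### Test functions give elements of `𝐕` -/

theorem memLp_partialDeriv {k : ℕ} {φ : E k → ℝ} (hφ : ContDiff ℝ ∞ φ)
    (hc : HasCompactSupport φ) (μ : Measure (E k)) [IsFiniteMeasureOnCompacts μ] (i : Fin k) :
    MemLp (partialDeriv i φ) 2 μ := by
  refine Continuous.memLp_of_hasCompactSupport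
    ((hφ.continuous_fderiv (by simp)).clm_apply continuous_const) (hc.mono' fun x hx => ?_)
  exact support_fderiv_subset ℝ (fun h0 => hx (by simp [partialDeriv, h0]))

/-- The constant sequence `φ` witnesses the trace relation. -/
theorem mem_VSpace_of_ae_eq {d : ℕ} {Ω : Set (E d)} (hΩ : IsBoundedSmoothDomain Ω)
    {φ : E d → ℝ} (hφ : ContDiff ℝ ∞ φ) (hc : HasCompactSupport φ) {p : HSpace Ω}
    (h1 : p.fst =ᵐ[bulkMeasure Ω] φ) (h2 : p.snd =ᵐ[surfaceMeasure Ω] φ) : p ∈ VSpace Ω := by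
  have := hΩ.isFiniteMeasure_bulkMeasure
  have hD : ∀ i, MemLp (partialDeriv i φ) 2 (bulkMeasure Ω) ∧
      HasWeakPartialDeriv Ω i p.fst (partialDeriv i φ) := fun i =>
    ⟨memLp_partialDeriv hφ hc _ i,
      (hasWeakPartialDeriv_of_contDiffOn hΩ.isOpen hφ.contDiffOn i).congr_ae h1⟩
  refine ⟨⟨Lp.memLp p.fst, fun i => ⟨_, hD i⟩⟩, ⟨Lp.memLp p.snd, fun W ψ hψ => ?_⟩,
    fun i => partialDeriv i φ, hD, fun _ => φ, fun _ => hφ, ?_, fun i => ?_, ?_⟩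
  · exact (memH1Loc_of_contDiffOn hψ.isOpen (hφ.comp_contDiffOn hψ.contDiffOn)).congr_ae
      (hψ.ae_eq_comp h2 isClosed_frontier.measurableSet)
  · have h0 : (fun x => φ x - p.fst x) =ᵐ[bulkMeasure Ω] 0 := by
      filter_upwards [h1] with x hx
      simp [hx]
    simp [eLpNorm_congr_ae h0]
  · simp
  · have h0 : (fun x => φ x - p.snd x) =ᵐ[surfaceMeasure Ω] 0 := by
      filter_upwards [h2] with x hx
      simp [hx]
    simp [eLpNorm_congr_ae h0]

/-! ### Simultaneous approximation in the bulk and on the boundary -/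

/-- Glue `f` on `A` to `g` on `Aᶜ` and approximate in `L²(μ + ν)`, whose norm dominates those of
`L²(μ)` and `L²(ν)`. -/
theorem exists_contDiff_eLpNorm_sub_le_and_le {k : ℕ} {μ ν : Measure (E k)}
    [IsFiniteMeasure μ] [IsFiniteMeasure ν] {A : Set (E k)} (hA : MeasurableSet A)
    (hμ : μ Aᶜ = 0) (hν : ν A = 0) {f g : E k → ℝ} (hf : MemLp f 2 μ) (hg : MemLp g 2 ν)
    {ε : ℝ} (hε : 0 < ε) :
    ∃ φ : E k → ℝ, HasCompactSupport φ ∧ ContDiff ℝ ∞ φ ∧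
      eLpNorm (f - φ) 2 μ ≤ ENNReal.ofReal ε ∧ eLpNorm (g - φ) 2 ν ≤ ENNReal.ofReal ε := by
  classical
  set F := A.piecewise f g
  have hFμ : F =ᵐ[μ] f := by
    filter_upwards [show ∀ᵐ x ∂μ, x ∈ A from hμ] with x hx using A.piecewise_eq_of_mem _ _ hx
  have hFν : F =ᵐ[ν] g := by
    filter_upwards [measure_eq_zero_iff_ae_notMem.1 hν] with x hx using
      A.piecewise_eq_of_notMem _ _ hx
  have hF : MemLp F 2 (μ + ν) :=
    MemLp.piecewise hA
      (by rw [Measure.restrict_add, Measure.restrict_eq_zero.2 hν, add_zero]; exact hf.restrict A)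
      (by rw [Measure.restrict_add, Measure.restrict_eq_zero.2 hμ, zero_add]; exact hg.restrict Aᶜ)
  obtain ⟨φ, hc, hφ, h⟩ := hF.exist_eLpNorm_sub_le (by simp) (by norm_num) hε
  refine ⟨φ, hc, hφ, ?_, ?_⟩
  · rw [← eLpNorm_congr_ae (hFμ.sub (ae_eq_refl φ))]
    exact (eLpNorm_mono_measure _ (Measure.le_add_right le_rfl)).trans h
  · rw [← eLpNorm_congr_ae (hFν.sub (ae_eq_refl φ))]
    exact (eLpNorm_mono_measure _ (Measure.le_add_left le_rfl)).trans h

theorem edist_toLp_le {α : Type*} [MeasurableSpace α] {μ : Measure α} (f : Lp ℝ 2 μ)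
    {φ : α → ℝ} (hφ : MemLp φ 2 μ) {c : ENNReal} (h : eLpNorm (⇑f - φ) 2 μ ≤ c) :
    edist (hφ.toLp φ) f ≤ c := by
  rw [edist_comm, Lp.edist_def]
  exact (eLpNorm_congr_ae ((ae_eq_refl f).sub hφ.coeFn_toLp)).trans_le h

end DynBdry

open DynBdry in
theorem proposition5p1 (d : ℕ) (hd : 1 ≤ d) (Ω : Set (EuclideanSpace ℝ (Fin d)))
    (hΩ : DynBdry.IsBoundedSmoothDomain Ω) :
    Dense (DynBdry.VSpace Ω) := by
  have := hΩ.isFiniteMeasure_bulkMeasure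
  have := hΩ.isFiniteMeasure_surfaceMeasure
  intro p
  have hμ : bulkMeasure Ω Ωᶜ = 0 := by
    rw [bulkMeasure, Measure.restrict_apply hΩ.isOpen.measurableSet.compl, Set.compl_inter_self,
      measure_empty]
  have hν : surfaceMeasure Ω Ω = 0 := by
    rw [surfaceMeasure, Measure.restrict_apply hΩ.isOpen.measurableSet,
      hΩ.isOpen.inter_frontier_eq, measure_empty]
  have hex : ∀ n : ℕ, _ := fun n => exists_contDiff_eLpNorm_sub_le_and_le
    hΩ.isOpen.measurableSet hμ hν (Lp.memLp p.fst) (Lp.memLp p.snd)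
    (Nat.one_div_pos_of_nat (α := ℝ) (n := n))
  choose φ hc hφ h1 h2 using hex
  have hm1 := fun n => (hφ n).continuous.memLp_of_hasCompactSupport (p := 2)
    (μ := bulkMeasure Ω) (hc n)
  have hm2 := fun n => (hφ n).continuous.memLp_of_hasCompactSupport (p := 2)
    (μ := surfaceMeasure Ω) (hc n)
  have hlim : Tendsto (fun n : ℕ => ENNReal.ofReal (1 / ((n : ℝ) + 1))) atTop (𝓝 0) := by
    simpa using ENNReal.tendsto_ofReal (tendsto_one_div_add_atTop_nhds_zero_nat (𝕜 := ℝ))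
  have ht1 : Tendsto (fun n => (hm1 n).toLp (φ n)) atTop (𝓝 p.fst) :=
    tendsto_iff_edist_tendsto_0.2 (tendsto_of_tendsto_of_tendsto_of_le_of_le tendsto_const_nhds
      hlim (fun _ => zero_le) fun n => edist_toLp_le _ _ (h1 n))
  have ht2 : Tendsto (fun n => (hm2 n).toLp (φ n)) atTop (𝓝 p.snd) :=
    tendsto_iff_edist_tendsto_0.2 (tendsto_of_tendsto_of_tendsto_of_le_of_le tendsto_const_nhds
      hlim (fun _ => zero_le) fun n => edist_toLp_le _ _ (h2 n))
  -- `WithLp 2` carries the product topology, so componentwise convergence suffices.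
  refine mem_closure_of_tendsto
    (((WithLp.prod_continuous_toLp 2 _ _).tendsto (p.fst, p.snd)).comp (ht1.prodMk_nhds ht2))
    (Eventually.of_forall fun n => ?_)
  exact mem_VSpace_of_ae_eq hΩ (hφ n) (hc n) (hm1 n).coeFn_toLp (hm2 n).coeFn_toLp
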